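/- Let $n$ and $k$ be integers with $1\le k\le n-1$. Let $\mathcal N_{n,k}$ be the real vector space of complex $n\times n$ skew-Hermitian matrices of bandwidth $k$, that is, of all $A\in\mathbb C^{n\times n}$ with $A^*=-A$ and $A_{ij}=0$ whenever $|i-j|>k$. Let $\mathcal D_{n,k}\subset\mathcal N_{n,k}$ be the subset of derogatory matrices, i.e. of those with an eigenvalue of geometric multiplicity greater than $1$. Then $\mathcal D_{n,k}$ has real codimension $3$ in $\mathcal N_{n,k}$: $\dim_{\mathbb R}\mathcal N_{n,k}-\dim_{\mathbb R}\mathcal D_{n,k}=3$. Here a subset $S$ of a finite-dimensional real vector space (possibly with singular points) is said to have dimension $d$ if some nonempty relatively open subset of $S$ is a smooth embedded submanifold of dimension $d$, and $S$ is contained in a countable union of smooth embedded submanifolds of dimension at most $d$. -/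

import Mathlib

open scoped ContDiff Matrix

-- Smoothness is independent of the choice of a norm on the (finite-dimensional) matrix spaces.
attribute [local instance] Matrix.frobeniusNormedAddCommGroup Matrix.frobeniusNormedSpace

/-- `M` is a smooth embedded submanifold, of dimension `d`, of the finite-dimensional real vector
space `E`: around each of its points there is a smooth chart `φ` of `E` which maps `M` onto (an open
piece of) a `d`-dimensional linear subspace. (The empty set is a submanifold of every dimension.) -/
def IsEmbeddedSubmanifold {E : Type*} [NormedAddCommGroup E] [NormedSpace ℝ E]
    (M : Set E) (d : ℕ) : Prop :=
  ∀ x ∈ M, ∃ (φ : OpenPartialHomeomorph E E) (F : Submodule ℝ E),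
    x ∈ φ.source ∧
    ContDiffOn ℝ ∞ φ φ.source ∧ ContDiffOn ℝ ∞ φ.symm φ.target ∧
    Module.finrank ℝ F = d ∧
    ∀ y ∈ φ.source, (y ∈ M ↔ φ y ∈ F)

/-- The subset `S` of `E`, possibly with singular points, has dimension `d`: a nonempty relatively
open part of `S` is an embedded submanifold of dimension `d`, and `S` is contained in a
countable union of embedded submanifolds of dimension at most `d`. There is at most one such `d`,
and for a nonempty embedded submanifold it is the dimension in the usual sense. -/
def HasDimension {E : Type*} [NormedAddCommGroup E] [NormedSpace ℝ E]
    (S : Set E) (d : ℕ) : Prop :=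
  (∃ U : Set E, IsOpen U ∧ (S ∩ U).Nonempty ∧ IsEmbeddedSubmanifold (S ∩ U) d) ∧
  ∃ M : ℕ → Set E, (∀ i, ∃ e ≤ d, IsEmbeddedSubmanifold (M i) e) ∧ S ⊆ ⋃ i, M i

/-- `S` has codimension `c` in the real vector space `E`: `dim E - dim S = c`. -/
def HasCodimension {E : Type*} [NormedAddCommGroup E] [NormedSpace ℝ E]
    (S : Set E) (c : ℕ) : Prop :=
  ∃ d : ℕ, HasDimension S d ∧ Module.finrank ℝ E = d + c

/-- The entries of `A` vanish at distance more than `k` from the diagonal. -/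
def IsBanded {n : ℕ} (k : ℕ) (A : Matrix (Fin n) (Fin n) ℂ) : Prop :=
  ∀ i j : Fin n, (k : ℤ) < |(j : ℤ) - (i : ℤ)| → A i j = 0

/-- `A` is derogatory: some eigenvalue has geometric multiplicity greater than one. -/
def IsDerogatory {n : ℕ} (A : Matrix (Fin n) (Fin n) ℂ) : Prop :=
  ∃ μ : ℂ, 1 < Module.finrank ℂ (Module.End.eigenspace (Matrix.toLin' A) μ)

/-- The real vector space of `n × n` complex skew-Hermitian matrices of bandwidth `k`. -/
def skewHermitianBanded (n k : ℕ) : Submodule ℝ (Matrix (Fin n) (Fin n) ℂ) where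
  carrier := {A | Aᴴ = -A ∧ IsBanded k A}
  add_mem' := by
    rintro A B ⟨hA, hA'⟩ ⟨hB, hB'⟩
    refine ⟨?_, fun i j h => ?_⟩
    · rw [Matrix.conjTranspose_add, hA, hB, neg_add]
    · rw [Matrix.add_apply, hA' i j h, hB' i j h, add_zero]
  zero_mem' := ⟨by simp, fun _ _ _ => rfl⟩
  smul_mem' := by
    rintro c A ⟨hA, hA'⟩
    refine ⟨?_, fun i j h => ?_⟩
    · rw [Matrix.conjTranspose_smul, hA, smul_neg, star_trivial]
    · rw [Matrix.smul_apply, hA' i j h, smul_zero]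

/-- The derogatory matrices among the skew-Hermitian matrices of bandwidth `k`. -/
def derogatorySkewHermitianBanded (n k : ℕ) : Set (skewHermitianBanded n k) :=
  {A | IsDerogatory (A : Matrix (Fin n) (Fin n) ℂ)}

/-!
Let `μ` be an eigenvalue of a skew-Hermitian matrix `A` whose eigenspace `V` has dimension at least
two, and let `J` be a set of coordinates onto which `V` projects isomorphically. Then the block of
`A - μ` outside `J` is invertible, and by Schur's formula the block of `A - μ` in `J` is a rational
function `S` of the remaining entries. So for `p ≠ q` in `J` the entries of `A` in the block with
rows and columns `p`, `q` are determined by `μ` and the other entries. Let `B` be `A - μ` with that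
block set to zero, except that `B p p = μ`. Adding `S` in the block, and `μ` to the diagonal entries
other than `(p, p)`, recovers `A` from `B`, and this map makes sense on an open set of all
skew-Hermitian matrices `B`. It is a local diffeomorphism: a vector `H` in the kernel of its
derivative equals `-H p p • 1` outside the block, which turns the equation at `(p, p)` into
`(1 + c) * H p p = 0` with `c ≥ 0`.

The matrices `B` obtained in this way satisfy `B q q = 0`, one real condition as `B` is
skew-Hermitian, and `B p q = 0`, a complex condition, which is three real conditions in all. If
`(p, q)` lies outside the band, then `B p q = 0` holds anyway. In that case take `q > p` to be the
first nonzero coordinate of an eigenvector `v`: the row `q - k` of `A v = μ v` shows that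
`B (q - k) q = 0`, which is the missing complex condition.

The finitely many choices of `J`, `p`, `q` therefore cover the derogatory matrices by submanifolds
of codimension three. Near a diagonal matrix with only one repeated eigenvalue, in places `p`, `q`,
Gershgorin's estimate forces `J = {p, q}`, so that there a single such submanifold consists of all
the derogatory matrices.
-/

section Submanifolds

open Topology

variable {E : Type*} [NormedAddCommGroup E] [NormedSpace ℝ E]

theorem exists_openPartialHomeomorph_of_injective_fderiv [FiniteDimensional ℝ E] {T : E → E}
    {U : Set E} (hU : IsOpen U) (hT : ∀ x ∈ U, ContDiffAt ℝ ∞ T x)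
    (hinj : ∀ x ∈ U, Function.Injective (fderiv ℝ T x)) {x : E} (hx : x ∈ U) :
    ∃ Φ : OpenPartialHomeomorph E E, x ∈ Φ.source ∧ Φ.source ⊆ U ∧ (∀ y, Φ y = T y) ∧
      ContDiffOn ℝ ∞ Φ Φ.source ∧ ContDiffOn ℝ ∞ Φ.symm Φ.target := by
  have : CompleteSpace E := FiniteDimensional.complete ℝ E
  have hderiv : ∀ y ∈ U, ∃ f' : E ≃L[ℝ] E, HasFDerivAt T (f' : E →L[ℝ] E) y := fun y hy =>
    ⟨(LinearEquiv.ofInjectiveEndo (fderiv ℝ T y : E →ₗ[ℝ] E) (hinj y hy)).toContinuousLinearEquiv,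
      ((hT y hy).differentiableAt (by simp)).hasFDerivAt⟩
  obtain ⟨f', hf'⟩ := hderiv x hx
  let Φ := ((hT x hx).toOpenPartialHomeomorph T hf' (by simp)).restrOpen U hU
  have hsource : Φ.source ⊆ U := fun y hy => hy.2
  have hΦ : (Φ : E → E) = T := rfl
  refine ⟨Φ, ⟨(hT x hx).mem_toOpenPartialHomeomorph_source hf' (by simp), hx⟩, hsource,
    fun _ => rfl, fun y hy => (hT y (hsource hy)).contDiffWithinAt, fun y hy => ?_⟩
  have hy' := hsource (Φ.map_target hy)
  obtain ⟨g', hg'⟩ := hderiv _ hy'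
  exact (Φ.contDiffAt_symm (f₀' := g') hy (hΦ ▸ hg') (hΦ ▸ hT _ hy')).contDiffWithinAt

theorem contDiffAt_restrict [FiniteDimensional ℝ E] {f : E → E} {W : Submodule ℝ E}
    (hf : Set.MapsTo f W W) {x : W} (h : ContDiffAt ℝ ∞ f x) :
    ContDiffAt ℝ ∞ (hf.restrict f W W) x := by
  obtain ⟨g, hg⟩ := W.subtype.exists_leftInverse_of_injective W.ker_subtype
  have hcomp : hf.restrict f W W = g.toContinuousLinearMap ∘ f ∘ W.subtypeL := by
    ext1 y
    exact (LinearMap.congr_fun hg (hf.restrict f W W y)).symm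
  rw [hcomp]
  exact g.toContinuousLinearMap.contDiff.contDiffAt.comp x
    (h.comp x W.subtypeL.contDiff.contDiffAt)

theorem injective_fderiv_restrict [FiniteDimensional ℝ E] {f : E → E} {W : Submodule ℝ E}
    (hf : Set.MapsTo f W W) {x : W} (h : ContDiffAt ℝ ∞ f x)
    (hinj : Function.Injective (fderiv ℝ f x)) :
    Function.Injective (fderiv ℝ (hf.restrict f W W) x) := by
  have hrestrict : W.subtypeL.comp (fderiv ℝ (hf.restrict f W W) x) =
      (fderiv ℝ f x).comp W.subtypeL :=
    (W.subtypeL.hasFDerivAt.comp x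
      ((contDiffAt_restrict hf h).differentiableAt (by simp)).hasFDerivAt).unique
      ((h.differentiableAt (by simp)).hasFDerivAt.comp x W.subtypeL.hasFDerivAt)
  have hcomp : Function.Injective (W.subtypeL.comp (fderiv ℝ (hf.restrict f W W) x)) :=
    hrestrict ▸ hinj.comp Subtype.val_injective
  exact Function.Injective.of_comp (f := W.subtypeL) hcomp

theorem isEmbeddedSubmanifold_image (Φ : OpenPartialHomeomorph E E)
    (hΦ : ContDiffOn ℝ ∞ Φ Φ.source) (hΦ' : ContDiffOn ℝ ∞ Φ.symm Φ.target)
    (F : Submodule ℝ E) :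
    IsEmbeddedSubmanifold (Φ '' (Φ.source ∩ F)) (Module.finrank ℝ F) := by
  rintro _ ⟨x, hx, rfl⟩
  refine ⟨Φ.symm, F, Φ.map_source hx.1, hΦ', hΦ, rfl, fun y hy => ⟨?_, fun h => ?_⟩⟩
  · rintro ⟨z, hz, rfl⟩
    rw [Φ.left_inv hz.1]
    exact hz.2
  · exact ⟨Φ.symm y, ⟨Φ.map_target hy, h⟩, Φ.right_inv hy⟩

theorem IsEmbeddedSubmanifold.inter_isOpen {M V : Set E} {d : ℕ} (hM : IsEmbeddedSubmanifold M d)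
    (hV : IsOpen V) : IsEmbeddedSubmanifold (M ∩ V) d := by
  rintro x ⟨hxM, hxV⟩
  obtain ⟨φ, F, hx, hφ, hφ', hF, hMF⟩ := hM x hxM
  refine ⟨φ.restrOpen V hV, F, ⟨hx, hxV⟩, hφ.mono fun y hy => hy.1, hφ'.mono fun y hy => hy.1, hF,
    fun y hy => ?_⟩
  exact (and_iff_left hy.2).trans (hMF y hy.1)

theorem IsEmbeddedSubmanifold.exists_isOpen_inter {M S : Set E} {d : ℕ}
    (hM : IsEmbeddedSubmanifold M d) (hMS : M ⊆ S) {x : E} (hx : x ∈ S)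
    (hSM : ∀ᶠ y in 𝓝 x, y ∈ S → y ∈ M) :
    ∃ U, IsOpen U ∧ (S ∩ U).Nonempty ∧ IsEmbeddedSubmanifold (S ∩ U) d := by
  obtain ⟨U, hUM, hU, hxU⟩ := eventually_nhds_iff.1 hSM
  have hSU : S ∩ U = M ∩ U :=
    Set.Subset.antisymm (fun y hy => ⟨hUM y hy.2 hy.1, hy.2⟩) (Set.inter_subset_inter_left U hMS)
  exact ⟨U, hU, ⟨x, hx, hxU⟩, hSU ▸ hM.inter_isOpen hU⟩

/-- The set `S` is contained in a countable union of embedded submanifolds of dimension `d`. -/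
def CoveredBySubmanifolds (S : Set E) (d : ℕ) : Prop :=
  ∃ 𝓜 : Set (Set E), 𝓜.Countable ∧ (∀ M ∈ 𝓜, IsEmbeddedSubmanifold M d) ∧ S ⊆ ⋃₀ 𝓜

namespace CoveredBySubmanifolds

theorem iUnion {ι : Sort*} [Countable ι] {S : ι → Set E} {d : ℕ}
    (h : ∀ i, CoveredBySubmanifolds (S i) d) : CoveredBySubmanifolds (⋃ i, S i) d := by
  choose 𝓜 hcount hmfd hcov using h
  refine ⟨⋃ i, 𝓜 i, Set.countable_iUnion hcount, fun M hM => ?_, Set.iUnion_subset fun i => ?_⟩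
  · obtain ⟨i, hi⟩ := Set.mem_iUnion.1 hM
    exact hmfd i M hi
  · exact (hcov i).trans (Set.sUnion_subset_sUnion (Set.subset_iUnion 𝓜 i))

theorem mono {S S' : Set E} {d : ℕ} (h : CoveredBySubmanifolds S d) (hS : S' ⊆ S) :
    CoveredBySubmanifolds S' d :=
  let ⟨𝓜, hcount, hmfd, hcov⟩ := h
  ⟨𝓜, hcount, hmfd, hS.trans hcov⟩

theorem exists_seq {S : Set E} {d : ℕ} (h : CoveredBySubmanifolds S d) :
    ∃ M : ℕ → Set E, (∀ i, ∃ e ≤ d, IsEmbeddedSubmanifold (M i) e) ∧ S ⊆ ⋃ i, M i := by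
  obtain ⟨𝓜, hcount, hmfd, hcov⟩ := h
  obtain ⟨M, hM⟩ := (hcount.insert ∅).exists_eq_range (Set.insert_nonempty _ _)
  refine ⟨M, fun i => ⟨d, le_rfl, ?_⟩, hcov.trans ?_⟩
  · rcases (hM ▸ Set.mem_range_self i : M i ∈ insert ∅ 𝓜) with h | h
    · exact fun x hx => (h ▸ hx : x ∈ (∅ : Set E)).elim
    · exact hmfd _ h
  · rw [← Set.sUnion_range, ← hM]
    exact Set.sUnion_subset_sUnion (Set.subset_insert ∅ 𝓜)

theorem image_of_injective_fderiv [FiniteDimensional ℝ E] {T : E → E} {U : Set E} (hU : IsOpen U)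
    (hT : ∀ x ∈ U, ContDiffAt ℝ ∞ T x) (hinj : ∀ x ∈ U, Function.Injective (fderiv ℝ T x))
    (F : Submodule ℝ E) : CoveredBySubmanifolds (T '' (U ∩ F)) (Module.finrank ℝ F) := by
  have : ProperSpace E := FiniteDimensional.proper ℝ E
  have : Nonempty (OpenPartialHomeomorph E E) := ⟨OpenPartialHomeomorph.refl E⟩
  choose! Φ hxΦ _ hΦT hΦ hΦ' using fun x (hx : x ∈ U) =>
    exists_openPartialHomeomorph_of_injective_fderiv hU hT hinj hx
  obtain ⟨t, htU, ht, hcov⟩ := TopologicalSpace.countable_cover_nhdsWithin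
    (f := fun x => (Φ x).source) (s := U)
    fun x hx => mem_nhdsWithin_of_mem_nhds ((Φ x).open_source.mem_nhds (hxΦ x hx))
  refine ⟨(fun x => Φ x '' ((Φ x).source ∩ F)) '' t, ht.image _, ?_, ?_⟩
  · rintro _ ⟨x, hx, rfl⟩
    exact isEmbeddedSubmanifold_image (Φ x) (hΦ x (htU hx)) (hΦ' x (htU hx)) F
  · rintro _ ⟨y, hy, rfl⟩
    obtain ⟨x, hx, hyx⟩ := Set.mem_iUnion₂.1 (hcov hy.1)
    exact ⟨_, ⟨x, hx, rfl⟩, y, ⟨hyx, hy.2⟩, hΦT x (htU hx) y⟩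

end CoveredBySubmanifolds

end Submanifolds

section SchurTerm

variable {𝕜 : Type*} [RCLike 𝕜] {ι κ : Type*} [Fintype ι]

/-- The compression `Eᴴ * X * E` of `X` to the column space of `E`, as a real linear map of `X`.
With `Eᴴ` in place of `E` it carries matrices on the column space back to the whole space. -/
noncomputable def compression (E : Matrix ι κ 𝕜) : Matrix ι ι 𝕜 →ₗ[ℝ] Matrix κ κ 𝕜 :=
  mulRightLinearMap κ ℝ E ∘ₗ mulLeftLinearMap ι ℝ Eᴴ

theorem compression_apply (E : Matrix ι κ 𝕜) (X : Matrix ι ι 𝕜) :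
    compression E X = Eᴴ * X * E :=
  rfl

theorem conjTranspose_compression (E : Matrix ι κ 𝕜) (X : Matrix ι ι 𝕜) :
    (compression E X)ᴴ = compression E Xᴴ := by
  simp [compression_apply, Matrix.mul_assoc]

variable [Fintype κ] [DecidableEq κ]

/-- The inverse of the compression of `X` to the column space of `E`, extended by zero to an
operator on the whole space. It is the junk value `0` where the compression is singular. -/
noncomputable def compressedInverse (E : Matrix ι κ 𝕜) (X : Matrix ι ι 𝕜) : Matrix ι ι 𝕜 :=
  compression Eᴴ (compression E X)⁻¹

/-- The term subtracted from `X` in the generalized Schur complement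
`X - X * E * (Eᴴ * X * E)⁻¹ * Eᴴ * X` of the compression of `X` to the column space of `E`. -/
noncomputable def schurTerm (E : Matrix ι κ 𝕜) (X : Matrix ι ι 𝕜) : Matrix ι ι 𝕜 :=
  X * compressedInverse E X * X

variable {E : Matrix ι κ 𝕜} {X : Matrix ι ι 𝕜}

theorem conjTranspose_inv_of_conjTranspose_eq_neg {M : Matrix κ κ 𝕜} (hM : Mᴴ = -M) :
    M⁻¹ᴴ = -M⁻¹ := by
  by_cases h : IsUnit M.det
  · rw [Matrix.conjTranspose_nonsing_inv, hM]
    exact Matrix.inv_eq_left_inv (by rw [neg_mul_neg, Matrix.nonsing_inv_mul M h])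
  · simp [Matrix.nonsing_inv_apply_not_isUnit M h]

theorem compressedInverse_apply (E : Matrix ι κ 𝕜) (X : Matrix ι ι 𝕜) :
    compressedInverse E X = E * (compression E X)⁻¹ * Eᴴ := by
  rw [compressedInverse, compression_apply, Matrix.conjTranspose_conjTranspose]

theorem conjTranspose_compressedInverse (hX : Xᴴ = -X) :
    (compressedInverse E X)ᴴ = -compressedInverse E X := by
  have hC : (compression E X)ᴴ = -compression E X := by rw [conjTranspose_compression, hX, map_neg]
  rw [compressedInverse, conjTranspose_compression,
    conjTranspose_inv_of_conjTranspose_eq_neg hC, map_neg]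

theorem conjTranspose_schurTerm (hX : Xᴴ = -X) : (schurTerm E X)ᴴ = -schurTerm E X := by
  simp [schurTerm, conjTranspose_compressedInverse hX, hX, Matrix.mul_assoc]

theorem schurTerm_congr {X' : Matrix ι ι 𝕜} (h : X * E = X' * E) (h' : Eᴴ * X = Eᴴ * X') :
    schurTerm E X = schurTerm E X' := by
  have hfactor (Y : Matrix ι ι 𝕜) : schurTerm E Y = Y * E * (Eᴴ * Y * E)⁻¹ * (Eᴴ * Y) := by
    simp only [schurTerm, compressedInverse_apply, compression_apply, Matrix.mul_assoc]
  rw [hfactor, hfactor, h, h']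

theorem compressedInverse_mul_mul (h : IsUnit (compression E X).det) :
    compressedInverse E X * X * E = E :=
  calc compressedInverse E X * X * E = E * ((compression E X)⁻¹ * compression E X) := by
        simp only [compressedInverse_apply, compression_apply, Matrix.mul_assoc]
    _ = E := by rw [Matrix.nonsing_inv_mul _ h, Matrix.mul_one]

theorem schurTerm_mul (h : IsUnit (compression E X).det) : schurTerm E X * E = X * E := by
  rw [schurTerm, Matrix.mul_assoc, Matrix.mul_assoc, ← Matrix.mul_assoc _ X,
    compressedInverse_mul_mul h]

theorem conjTranspose_mul_schurTerm (h : IsUnit (compression E X).det) :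
    Eᴴ * schurTerm E X = Eᴴ * X :=
  calc Eᴴ * schurTerm E X = compression E X * (compression E X)⁻¹ * (Eᴴ * X) := by
        simp only [schurTerm, compressedInverse_apply, compression_apply, Matrix.mul_assoc]
    _ = Eᴴ * X := by rw [Matrix.mul_nonsing_inv _ h, Matrix.one_mul]

theorem isUnit_det_compression_of_isCompl (hX : Xᴴ = -X) (hE : Function.Injective E.mulVec)
    (h : IsCompl (LinearMap.ker X.mulVecLin) (LinearMap.range E.mulVecLin)) :
    IsUnit (compression E X).det := by
  open scoped ComplexOrder in
  rw [isUnit_iff_ne_zero]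
  intro hdet
  obtain ⟨w, hw, hEXEw⟩ := Matrix.exists_mulVec_eq_zero_iff.2 hdet
  set y := X *ᵥ (E *ᵥ w) with hy
  have hEy : Eᴴ *ᵥ y = 0 := by
    rwa [hy, Matrix.mulVec_mulVec, Matrix.mulVec_mulVec, ← compression_apply]
  obtain ⟨z, _, hz, ⟨u, rfl⟩, hzu⟩ := Submodule.codisjoint_iff_exists_add_eq.1 h.codisjoint y
  have hzX : star z ᵥ* X = 0 := by
    rw [← Matrix.conjTranspose_conjTranspose X, ← Matrix.star_mulVec, hX, Matrix.neg_mulVec,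
      show X *ᵥ z = 0 from hz, neg_zero, star_zero]
  have hyz : star z ⬝ᵥ y = 0 := by rw [hy, Matrix.dotProduct_mulVec, hzX, zero_dotProduct]
  have hyu : star (E *ᵥ u) ⬝ᵥ y = 0 := by
    rw [Matrix.star_mulVec, ← Matrix.dotProduct_mulVec, hEy, dotProduct_zero]
  have hy0 : y = 0 := dotProduct_star_self_eq_zero.1 <| by
    nth_rw 1 [← hzu]
    rw [star_add, add_dotProduct, hyz, Matrix.mulVecLin_apply, hyu, add_zero]
  have hEw : E *ᵥ w = 0 := Submodule.disjoint_def.1 h.disjoint _ hy0 ⟨w, rfl⟩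
  exact hw (hE (hEw.trans (Matrix.mulVec_zero E).symm))

theorem isCompl_ker_range_iff (hunit : IsUnit (compression E X).det) :
    IsCompl (LinearMap.ker X.mulVecLin) (LinearMap.range E.mulVecLin) ↔ schurTerm E X = X := by
  refine ⟨fun h => Matrix.ext_iff_mulVec.2 fun x => ?_, fun h => ⟨?_, ?_⟩⟩
  · obtain ⟨z, _, hz, ⟨u, rfl⟩, rfl⟩ :=
      Submodule.codisjoint_iff_exists_add_eq.1 h.codisjoint x
    have hz : X *ᵥ z = 0 := hz
    have hSz : schurTerm E X *ᵥ z = 0 := by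
      rw [schurTerm, ← Matrix.mulVec_mulVec, hz, Matrix.mulVec_zero]
    rw [Matrix.mulVec_add, Matrix.mulVec_add, hSz, hz, Matrix.mulVecLin_apply,
      Matrix.mulVec_mulVec, Matrix.mulVec_mulVec, schurTerm_mul hunit]
  · refine Submodule.disjoint_def.2 ?_
    rintro _ hw ⟨w, rfl⟩
    have hw : X *ᵥ (E *ᵥ w) = 0 := hw
    rw [Matrix.mulVecLin_apply, ← compressedInverse_mul_mul hunit, ← Matrix.mulVec_mulVec,
      ← Matrix.mulVec_mulVec, hw, Matrix.mulVec_zero]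
  · refine codisjoint_iff.2 (eq_top_iff.2 fun x _ => Submodule.mem_sup.2
      ⟨x - compressedInverse E X *ᵥ (X *ᵥ x), ?_, compressedInverse E X *ᵥ (X *ᵥ x),
        ⟨(compression E X)⁻¹ *ᵥ (Eᴴ *ᵥ (X *ᵥ x)), ?_⟩, sub_add_cancel _ _⟩)
    · rw [LinearMap.mem_ker, Matrix.mulVecLin_apply, Matrix.mulVec_sub, Matrix.mulVec_mulVec,
        Matrix.mulVec_mulVec, ← schurTerm, h, sub_self]
    · simp only [Matrix.mulVecLin_apply, Matrix.mulVec_mulVec, compressedInverse_apply,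
        Matrix.mul_assoc]

theorem isCompl_ker_schurTerm (hunit : IsUnit (compression E X).det) :
    IsCompl (LinearMap.ker (schurTerm E X).mulVecLin) (LinearMap.range E.mulVecLin) := by
  have hcompr : compression E (schurTerm E X) = compression E X := by
    rw [compression_apply, conjTranspose_mul_schurTerm hunit, ← compression_apply]
  exact (isCompl_ker_range_iff (hcompr ▸ hunit)).2
    (schurTerm_congr (schurTerm_mul hunit) (conjTranspose_mul_schurTerm hunit))

section Derivatives

attribute [local instance] Matrix.frobeniusNormedRing Matrix.frobeniusNormedAlgebra

theorem compressedInverse_eq_comp (E : Matrix ι κ 𝕜) :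
    compressedInverse E = compression Eᴴ ∘ Ring.inverse ∘ compression E := by
  ext1 X
  rw [compressedInverse, Matrix.nonsing_inv_eq_ringInverse, Function.comp_apply,
    Function.comp_apply]

theorem contDiffAt_compressedInverse (h : IsUnit (compression E X).det) :
    ContDiffAt ℝ ∞ (compressedInverse E) X := by
  rw [compressedInverse_eq_comp]
  exact (compression Eᴴ).toContinuousLinearMap.contDiff.contDiffAt.comp X
    ((contDiffAt_ringInverse ℝ ((Matrix.isUnit_iff_isUnit_det _).2 h).unit).comp X
      (compression E).toContinuousLinearMap.contDiff.contDiffAt)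

theorem fderiv_compressedInverse_apply (h : IsUnit (compression E X).det) (H : Matrix ι ι 𝕜) :
    fderiv ℝ (compressedInverse E) X H =
      -(compressedInverse E X * H * compressedInverse E X) := by
  have hu := (Matrix.isUnit_iff_isUnit_det _).2 h
  have hderiv := (compression Eᴴ).toContinuousLinearMap.hasFDerivAt.comp X
    ((hasFDerivAt_ringInverse (𝕜 := ℝ) hu.unit).comp X
      (compression E).toContinuousLinearMap.hasFDerivAt)
  have hinv : (↑hu.unit⁻¹ : Matrix κ κ 𝕜) = (compression E X)⁻¹ := by
    rw [← Ring.inverse_unit, IsUnit.unit_spec, Matrix.nonsing_inv_eq_ringInverse]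
  rw [hinv] at hderiv
  have hfderiv : fderiv ℝ (compressedInverse E) X = _ :=
    (congrArg (fderiv ℝ · X) (compressedInverse_eq_comp E)).trans (HasFDerivAt.fderiv hderiv)
  rw [hfderiv]
  change compression Eᴴ (-((compression E X)⁻¹ * compression E H * (compression E X)⁻¹)) = _
  simp only [compressedInverse_apply, compression_apply, Matrix.conjTranspose_conjTranspose,
    Matrix.mul_neg, Matrix.neg_mul, Matrix.mul_assoc]

theorem contDiffAt_schurTerm (h : IsUnit (compression E X).det) :
    ContDiffAt ℝ ∞ (schurTerm E) X := by
  classical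
  exact (contDiffAt_id.mul (contDiffAt_compressedInverse h)).mul contDiffAt_id

theorem fderiv_schurTerm_apply (h : IsUnit (compression E X).det) (H : Matrix ι ι 𝕜) :
    fderiv ℝ (schurTerm E) X H =
      H * compressedInverse E X * X - X * compressedInverse E X * H * compressedInverse E X * X +
        X * compressedInverse E X * H := by
  classical
  have hW : HasFDerivAt (compressedInverse E) (fderiv ℝ (compressedInverse E) X) X :=
    ((contDiffAt_compressedInverse h).differentiableAt (by simp)).hasFDerivAt
  have hderiv := ((hasFDerivAt_id (𝕜 := ℝ) X).mul' hW).mul' (hasFDerivAt_id X)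
  have happly := DFunLike.congr_fun (HasFDerivAt.fderiv hderiv) H
  refine happly.trans ?_
  change X * compressedInverse E X * H + (X * fderiv ℝ (compressedInverse E) X H +
    H * compressedInverse E X) * X = _
  rw [fderiv_compressedInverse_apply h]
  noncomm_ring

theorem fderiv_schurTerm_apply_of_mul_eq_smul {H : Matrix ι ι 𝕜} {η : 𝕜}
    (h : IsUnit (compression E X).det) (hX : Xᴴ = -X) (hHE : H * E = η • E)
    (hEH : Eᴴ * H = η • Eᴴ) :
    fderiv ℝ (schurTerm E) X H =
      η • (compressedInverse E X * X - X * compressedInverse E X * (X * compressedInverse E X)ᴴ +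
        X * compressedInverse E X) := by
  have hHW : H * compressedInverse E X = η • compressedInverse E X := by
    simp only [compressedInverse_apply, ← Matrix.mul_assoc, hHE, Matrix.smul_mul]
  have hWH : compressedInverse E X * H = η • compressedInverse E X := by
    simp only [compressedInverse_apply, Matrix.mul_assoc, hEH, Matrix.mul_smul]
  have hadj : (X * compressedInverse E X)ᴴ = compressedInverse E X * X := by
    rw [Matrix.conjTranspose_mul, hX, conjTranspose_compressedInverse hX, neg_mul_neg]
  rw [fderiv_schurTerm_apply h, hadj, hHW, Matrix.mul_assoc X _ H, hWH]
  simp only [Matrix.smul_mul, Matrix.mul_smul, smul_sub, smul_add, Matrix.mul_assoc]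

open scoped ComplexOrder in
theorem exists_fderiv_schurTerm_apply_self {H : Matrix ι ι 𝕜} {η : 𝕜} {i : ι}
    (h : IsUnit (compression E X).det) (hX : Xᴴ = -X) (hHE : H * E = η • E)
    (hEH : Eᴴ * H = η • Eᴴ) (hi : ∀ j, E i j = 0) :
    ∃ c : 𝕜, 0 ≤ c ∧ fderiv ℝ (schurTerm E) X H i i = -(η * c) := by
  have hWX : (compressedInverse E X * X) i i = 0 := by
    simp [compressedInverse_apply, Matrix.mul_assoc, Matrix.mul_apply (M := E), hi]
  have hXW : (X * compressedInverse E X) i i = 0 := by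
    simp [compressedInverse_apply, ← Matrix.mul_assoc, Matrix.mul_apply (N := Eᴴ), hi]
  refine ⟨_, (Matrix.posSemidef_self_mul_conjTranspose
    (X * compressedInverse E X)).diag_nonneg (i := i), ?_⟩
  rw [fderiv_schurTerm_apply_of_mul_eq_smul h hX hHE hEH]
  simp [hWX, hXW]

end Derivatives

end SchurTerm

section CoordinateSets

variable {ι : Type*} (𝕜 : Type*) [RCLike 𝕜]

/-- The subspace of the vectors whose coordinates with indices in `J` vanish. -/
def vanishingOn (J : Finset ι) : Submodule 𝕜 (ι → 𝕜) :=
  Submodule.pi (J : Set ι) fun _ => ⊥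

variable {𝕜}

theorem mem_vanishingOn {J : Finset ι} {z : ι → 𝕜} : z ∈ vanishingOn 𝕜 J ↔ ∀ j ∈ J, z j = 0 := by
  simp [vanishingOn]

variable [DecidableEq ι]

theorem codisjoint_vanishingOn_pair {V : Submodule 𝕜 (ι → 𝕜)} {p q : ι} {u v : ι → 𝕜}
    (hu : u ∈ V) (hv : v ∈ V) (hup : u p ≠ 0) (hvp : v p = 0) (hvq : v q ≠ 0) :
    Codisjoint V (vanishingOn 𝕜 {p, q}) := by
  refine Submodule.codisjoint_iff_exists_add_eq.2 fun y => ?_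
  let a := y p / u p
  let b := (y q - a * u q) / v q
  refine ⟨a • u + b • v, y - (a • u + b • v), V.add_mem (V.smul_mem a hu) (V.smul_mem b hv),
    mem_vanishingOn.2 ?_, add_sub_cancel _ _⟩
  simp [a, b, hup, hvp, hvq]

/-- The matrix whose columns are the standard basis vectors with indices outside `J`. -/
def coordFrame (𝕜 : Type*) [RCLike 𝕜] (J : Finset ι) : Matrix ι {i // i ∉ J} 𝕜 :=
  (1 : Matrix ι ι 𝕜).submatrix id Subtype.val

theorem coordFrame_apply_eq_zero {J : Finset ι} {i : ι} (hi : i ∈ J) (j : {i // i ∉ J}) :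
    coordFrame 𝕜 J i j = 0 :=
  Matrix.one_apply_ne fun h => j.2 (h ▸ hi)

variable [Fintype ι]

theorem mul_coordFrame {κ : Type*} (J : Finset ι) (X : Matrix κ ι 𝕜) :
    X * coordFrame 𝕜 J = X.submatrix id Subtype.val :=
  Matrix.mul_submatrix_one (Equiv.refl ι) Subtype.val X

theorem conjTranspose_coordFrame_mul {κ : Type*} (J : Finset ι) (X : Matrix ι κ 𝕜) :
    (coordFrame 𝕜 J)ᴴ * X = X.submatrix Subtype.val id := by
  rw [coordFrame, Matrix.conjTranspose_submatrix, Matrix.conjTranspose_one]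
  exact Matrix.one_submatrix_mul Subtype.val (Equiv.refl ι) X

theorem conjTranspose_coordFrame_mul_self (J : Finset ι) :
    (coordFrame 𝕜 J)ᴴ * coordFrame 𝕜 J = 1 := by
  rw [conjTranspose_coordFrame_mul]
  exact Matrix.submatrix_one _ Subtype.val_injective

theorem coordFrame_mulVec_injective (J : Finset ι) :
    Function.Injective (coordFrame 𝕜 J).mulVec := by
  intro v w h
  simpa [Matrix.mulVec_mulVec, conjTranspose_coordFrame_mul_self] using
    congrArg ((coordFrame 𝕜 J)ᴴ *ᵥ ·) h

theorem range_coordFrame (J : Finset ι) :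
    LinearMap.range (coordFrame 𝕜 J).mulVecLin = vanishingOn 𝕜 J := by
  ext z
  rw [mem_vanishingOn]
  refine ⟨?_, fun hz => ⟨fun i => z i, ?_⟩⟩
  · rintro ⟨w, rfl⟩ j hj
    exact Finset.sum_eq_zero fun i _ => mul_eq_zero_of_left (coordFrame_apply_eq_zero hj i) _
  · ext i
    by_cases hi : i ∈ J
    · rw [hz i hi]
      exact Finset.sum_eq_zero fun j _ => mul_eq_zero_of_left (coordFrame_apply_eq_zero hi j) _
    · refine (Finset.sum_eq_single ⟨i, hi⟩ ?_ ?_).trans ?_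
      all_goals simp [coordFrame, Matrix.one_apply]
      grind

end CoordinateSets

section CoordinateComplements

variable {𝕜 : Type*} [RCLike 𝕜] {ι : Type*}

theorem finrank_vanishingOn_add_card [Fintype ι] (J : Finset ι) :
    Module.finrank 𝕜 (vanishingOn 𝕜 J) + J.card = Fintype.card ι := by
  classical
  have hinj : Function.Injective (coordFrame 𝕜 J).mulVecLin := coordFrame_mulVec_injective J
  rw [← range_coordFrame, LinearMap.finrank_range_of_inj hinj, Module.finrank_fintype_fun_eq_card,
    Fintype.card_subtype_compl, Fintype.card_coe, Nat.sub_add_cancel (Finset.card_le_univ J)]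

variable [Finite ι] {V : Submodule 𝕜 (ι → 𝕜)} {J : Finset ι}

theorem finrank_eq_card_of_isCompl_vanishingOn (h : IsCompl V (vanishingOn 𝕜 J)) :
    Module.finrank 𝕜 V = J.card := by
  have := Fintype.ofFinite ι
  have := Submodule.finrank_add_eq_of_isCompl h
  rw [Module.finrank_fintype_fun_eq_card, ← finrank_vanishingOn_add_card (𝕜 := 𝕜) J] at this
  lia

theorem isCompl_vanishingOn_of_card_le (hcard : J.card ≤ Module.finrank 𝕜 V)
    (h : ∀ z ∈ V, (∀ j ∈ J, z j = 0) → z = 0) : IsCompl V (vanishingOn 𝕜 J) := by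
  have := Fintype.ofFinite ι
  refine (Submodule.isCompl_iff_disjoint _ _ ?_).2
    (Submodule.disjoint_def.2 fun z hz hzJ => h z hz (mem_vanishingOn.1 hzJ))
  rw [Module.finrank_fintype_fun_eq_card, ← finrank_vanishingOn_add_card (𝕜 := 𝕜) J]
  lia

theorem exists_isCompl_vanishingOn_of_codisjoint (h : Codisjoint V (vanishingOn 𝕜 J)) :
    ∃ J', J ⊆ J' ∧ IsCompl V (vanishingOn 𝕜 J') := by
  classical
  obtain ⟨J', hJJ', hcodisj, hmax⟩ :=
    Finite.exists_le_maximal (p := fun J => Codisjoint V (vanishingOn 𝕜 J)) h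
  refine ⟨J', hJJ', Submodule.disjoint_def.2 fun x hxV hxJ => ?_, hcodisj⟩
  by_contra hx
  obtain ⟨i, hi⟩ : ∃ i, x i ≠ 0 := Function.ne_iff.1 hx
  suffices hins : Codisjoint V (vanishingOn 𝕜 (insert i J')) from
    hi (mem_vanishingOn.1 hxJ i
      (hmax hins (Finset.subset_insert i J') (Finset.mem_insert_self i J')))
  refine Submodule.codisjoint_iff_exists_add_eq.2 fun y => ?_
  obtain ⟨v, w, hv, hw, rfl⟩ := Submodule.codisjoint_iff_exists_add_eq.1 hcodisj y
  refine ⟨v + (w i / x i) • x, w - (w i / x i) • x, V.add_mem hv (V.smul_mem _ hxV), ?_, by abel⟩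
  have hwx := (vanishingOn 𝕜 J').sub_mem hw ((vanishingOn 𝕜 J').smul_mem (w i / x i) hxJ)
  refine mem_vanishingOn.2 fun j hj => ?_
  rcases Finset.mem_insert.1 hj with rfl | hj
  · simp [hi]
  · exact mem_vanishingOn.1 hwx j hj

end CoordinateComplements

section BandBlock

variable {n : ℕ} {k : ℕ} {s : Finset (Fin n)}

/-- The truncation of a matrix to the entries which lie both in the square block with rows and
columns `s` and in the band of width `k`. -/
def bandBlock (k : ℕ) (s : Finset (Fin n)) :
    Matrix (Fin n) (Fin n) ℂ →ₗ[ℝ] Matrix (Fin n) (Fin n) ℂ where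
  toFun A := Matrix.of fun i j => if i ∈ s ∧ j ∈ s ∧ |(j : ℤ) - i| ≤ k then A i j else 0
  map_add' A B := by
    ext i j
    simp only [Matrix.of_apply, Matrix.add_apply]
    split_ifs <;> simp
  map_smul' c A := by
    ext i j
    simp

theorem bandBlock_apply (k : ℕ) (s : Finset (Fin n)) (A : Matrix (Fin n) (Fin n) ℂ) (i j : Fin n) :
    bandBlock k s A i j = if i ∈ s ∧ j ∈ s ∧ |(j : ℤ) - i| ≤ k then A i j else 0 :=
  rfl

theorem bandBlock_single {p : Fin n} (hp : p ∈ s) (c : ℂ) :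
    bandBlock k s (Matrix.single p p c) = Matrix.single p p c := by
  ext i j
  rw [bandBlock_apply, ite_eq_left_iff]
  intro h
  refine (Matrix.single_apply_of_ne _ _ _ _ _ ?_).symm
  rintro ⟨rfl, rfl⟩
  simp [hp] at h

theorem bandBlock_mem_skewHermitianBanded {A : Matrix (Fin n) (Fin n) ℂ} (hA : Aᴴ = -A) :
    bandBlock k s A ∈ skewHermitianBanded n k := by
  refine ⟨?_, fun i j hij => if_neg fun h => hij.not_ge h.2.2⟩
  rw [← map_neg, ← hA]
  ext i j
  simp only [Matrix.conjTranspose_apply, bandBlock_apply, apply_ite star, star_zero]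
  rw [abs_sub_comm]
  exact if_congr (by tauto) rfl rfl

theorem smul_one_mem_skewHermitianBanded {μ : ℂ} (hμ : star μ = -μ) :
    μ • (1 : Matrix (Fin n) (Fin n) ℂ) ∈ skewHermitianBanded n k := by
  refine ⟨by rw [Matrix.conjTranspose_smul, Matrix.conjTranspose_one, hμ, neg_smul],
    fun i j h => ?_⟩
  have hij : i ≠ j := by
    rintro rfl
    exact h.not_ge (by simp)
  simp [hij]

theorem conjTranspose_single_eq_neg {p : Fin n} {μ : ℂ} (hμ : star μ = -μ) :
    (Matrix.single p p μ)ᴴ = -Matrix.single p p μ := by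
  rw [Matrix.conjTranspose_single, hμ, Matrix.single_neg]

theorem star_diag_eq_neg {A : Matrix (Fin n) (Fin n) ℂ} (hA : Aᴴ = -A) (p : Fin n) :
    star (A p p) = -A p p :=
  congrFun₂ hA p p

variable {J : Finset (Fin n)}

theorem bandBlock_mul_coordFrame (hs : s ⊆ J) (A : Matrix (Fin n) (Fin n) ℂ) :
    bandBlock k s A * coordFrame ℂ J = 0 := by
  rw [mul_coordFrame]
  ext i j
  exact if_neg fun h => j.2 (hs h.2.1)

theorem conjTranspose_coordFrame_mul_bandBlock (hs : s ⊆ J) (A : Matrix (Fin n) (Fin n) ℂ) :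
    (coordFrame ℂ J)ᴴ * bandBlock k s A = 0 := by
  rw [conjTranspose_coordFrame_mul]
  ext i j
  exact if_neg fun h => i.2 (hs h.1)

theorem bandBlock_eq_self {A : Matrix (Fin n) (Fin n) ℂ}
    (hs : ∀ i ∈ s, ∀ j ∈ s, |(j : ℤ) - i| ≤ k) (hA : A * coordFrame ℂ s = 0)
    (hA' : (coordFrame ℂ s)ᴴ * A = 0) : bandBlock k s A = A := by
  rw [mul_coordFrame] at hA
  rw [conjTranspose_coordFrame_mul] at hA'
  ext i j
  rw [bandBlock_apply, ite_eq_left_iff]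
  intro h
  by_cases hi : i ∈ s
  · by_cases hj : j ∈ s
    · exact absurd ⟨hi, hj, hs i hi j hj⟩ h
    · exact (congrFun₂ hA i ⟨j, hj⟩).symm
  · exact (congrFun₂ hA' ⟨i, hi⟩ j).symm

theorem schurTerm_add_bandBlock (hs : s ⊆ J) (X A : Matrix (Fin n) (Fin n) ℂ) :
    schurTerm (coordFrame ℂ J) (X + bandBlock k s A) = schurTerm (coordFrame ℂ J) X :=
  schurTerm_congr (by rw [Matrix.add_mul, bandBlock_mul_coordFrame hs, add_zero])
    (by rw [Matrix.mul_add, conjTranspose_coordFrame_mul_bandBlock hs, add_zero])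

theorem compression_add_bandBlock (hs : s ⊆ J) (X A : Matrix (Fin n) (Fin n) ℂ) :
    compression (coordFrame ℂ J) (X + bandBlock k s A) = compression (coordFrame ℂ J) X := by
  rw [map_add, compression_apply _ (bandBlock k s A), conjTranspose_coordFrame_mul_bandBlock hs,
    Matrix.zero_mul, add_zero]

end BandBlock

section SchurShift

variable {n : ℕ} {k : ℕ} {J : Finset (Fin n)} {p q : Fin n} {X : Matrix (Fin n) (Fin n) ℂ}

/-- The parametrization of the matrices with a multiple eigenvalue. The entry `X p p` stands for the
eigenvalue `μ`, which is added to the other diagonal entries; in the block with rows and columns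
`p`, `q`, as far as it lies in the band, the entries of `S` are added as well, where `S` is the
Schur term of `X` over the coordinates outside `J`. -/
noncomputable def schurShift (k : ℕ) (J : Finset (Fin n)) (p q : Fin n)
    (X : Matrix (Fin n) (Fin n) ℂ) : Matrix (Fin n) (Fin n) ℂ :=
  X + X p p • (1 - Matrix.single p p 1) + bandBlock k {p, q} (schurTerm (coordFrame ℂ J) X)

theorem schurShift_eq_add_smul_one (k : ℕ) (J : Finset (Fin n)) (p q : Fin n)
    (X : Matrix (Fin n) (Fin n) ℂ) :
    schurShift k J p q X =
      X + bandBlock k {p, q} (schurTerm (coordFrame ℂ J) X - Matrix.single p p (X p p)) +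
        X p p • 1 := by
  rw [map_sub, bandBlock_single (by simp), schurShift, smul_sub, Matrix.smul_single, smul_eq_mul,
    mul_one]
  abel

theorem mapsTo_schurShift (k : ℕ) (J : Finset (Fin n)) (p q : Fin n) :
    Set.MapsTo (schurShift k J p q) (skewHermitianBanded n k) (skewHermitianBanded n k) := by
  intro X hX
  rw [schurShift_eq_add_smul_one]
  have hpp := star_diag_eq_neg hX.1 p
  refine add_mem (add_mem hX (bandBlock_mem_skewHermitianBanded ?_))
    (smul_one_mem_skewHermitianBanded hpp)
  rw [Matrix.conjTranspose_sub, conjTranspose_schurTerm hX.1, conjTranspose_single_eq_neg hpp]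
  abel

theorem contDiffAt_schurShift (p q : Fin n) (h : IsUnit (compression (coordFrame ℂ J) X).det) :
    ContDiffAt ℝ ∞ (schurShift k J p q) X :=
  (contDiffAt_id.add (((Matrix.entryLinearMap ℝ ℂ p p).smulRight
    (1 - Matrix.single p p 1)).toContinuousLinearMap.contDiff.contDiffAt)).add
    ((bandBlock k {p, q}).toContinuousLinearMap.contDiff.contDiffAt.comp X (contDiffAt_schurTerm h))

theorem fderiv_schurShift_apply (h : IsUnit (compression (coordFrame ℂ J) X).det)
    (H : Matrix (Fin n) (Fin n) ℂ) :
    fderiv ℝ (schurShift k J p q) X H = H + H p p • (1 - Matrix.single p p 1) +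
      bandBlock k {p, q} (fderiv ℝ (schurTerm (coordFrame ℂ J)) X H) := by
  have hderiv := ((hasFDerivAt_id X).add (((Matrix.entryLinearMap ℝ ℂ p p).smulRight
    (1 - Matrix.single p p 1)).toContinuousLinearMap.hasFDerivAt (x := X))).add
    ((bandBlock k {p, q}).toContinuousLinearMap.hasFDerivAt.comp X
      ((contDiffAt_schurTerm h).differentiableAt (by simp)).hasFDerivAt)
  exact DFunLike.congr_fun (HasFDerivAt.fderiv hderiv) H

open scoped ComplexOrder in
theorem injective_fderiv_schurShift (hpJ : p ∈ J) (hqJ : q ∈ J) (hX : Xᴴ = -X)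
    (h : IsUnit (compression (coordFrame ℂ J) X).det) :
    Function.Injective (fderiv ℝ (schurShift k J p q) X) := by
  refine (injective_iff_map_eq_zero _).2 fun H hH => ?_
  rw [fderiv_schurShift_apply h] at hH
  set D := fderiv ℝ (schurTerm (coordFrame ℂ J)) X H with hD
  have hpq : {p, q} ⊆ J := by simp [Finset.insert_subset_iff, hpJ, hqJ]
  have hHZ : H = (-H p p) • 1 + bandBlock k {p, q} (Matrix.single p p (H p p) - D) := by
    rw [← sub_eq_zero, ← hH, map_sub, bandBlock_single (by simp), smul_sub, Matrix.smul_single,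
      smul_eq_mul, mul_one, neg_smul]
    abel
  have hHE : H * coordFrame ℂ J = (-H p p) • coordFrame ℂ J := by
    nth_rw 1 [hHZ]
    rw [Matrix.add_mul, bandBlock_mul_coordFrame hpq, Matrix.smul_mul, Matrix.one_mul, add_zero]
  have hEH : (coordFrame ℂ J)ᴴ * H = (-H p p) • (coordFrame ℂ J)ᴴ := by
    nth_rw 1 [hHZ]
    rw [Matrix.mul_add, conjTranspose_coordFrame_mul_bandBlock hpq, Matrix.mul_smul,
      Matrix.mul_one, add_zero]
  have hpp : H p p = 0 := by
    obtain ⟨c, hc, hDpp⟩ :=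
      exists_fderiv_schurTerm_apply_self h hX hHE hEH (coordFrame_apply_eq_zero hpJ)
    have hdiag : H p p + D p p = 0 := by simpa [bandBlock_apply] using congrFun₂ hH p p
    have hentry : H p p * (1 + c) = 0 := by linear_combination hdiag - hDpp
    exact (mul_eq_zero.1 hentry).resolve_right (add_pos_of_pos_of_nonneg one_pos hc).ne'
  have hD0 : D = 0 := by
    rw [hD, fderiv_schurTerm_apply_of_mul_eq_smul h hX hHE hEH, hpp, neg_zero, zero_smul]
  simpa [hpp, hD0] using hH

end SchurShift

section Eigenspaces

variable {ι : Type*}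

theorem eigenspace_toLin'_eq_ker [Fintype ι] [DecidableEq ι] (A : Matrix ι ι ℂ) (μ : ℂ) :
    Module.End.eigenspace (Matrix.toLin' A) μ = LinearMap.ker (A - μ • 1).mulVecLin := by
  rw [Module.End.eigenspace_def, ← Matrix.toLin'_apply', map_sub, map_smul, Matrix.toLin'_one]
  rfl

theorem exists_eq_ofReal_mul_I_of_mulVec_eq_smul [Fintype ι] {A : Matrix ι ι ℂ} (hA : Aᴴ = -A)
    {μ : ℂ} {z : ι → ℂ} (hz : A *ᵥ z = μ • z) (hz0 : z ≠ 0) : ∃ t : ℝ, μ = t * Complex.I := by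
  open scoped ComplexOrder in
  have hzA : star z ᵥ* A = (-star μ) • star z := by
    rw [← Matrix.conjTranspose_conjTranspose A, ← Matrix.star_mulVec, hA, Matrix.neg_mulVec, hz,
      star_neg, star_smul, neg_smul]
  have hmul : -star μ * (star z ⬝ᵥ z) = μ * (star z ⬝ᵥ z) := by
    rw [← smul_eq_mul, ← smul_dotProduct, ← hzA, ← Matrix.dotProduct_mulVec, hz, dotProduct_smul,
      smul_eq_mul]
  have hμ := congrArg Complex.re (mul_right_cancel₀ (dotProduct_star_self_eq_zero.not.2 hz0) hmul)
  simp only [Complex.star_def, Complex.neg_re, Complex.conj_re] at hμ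
  exact ⟨μ.im, Complex.ext (by simp; linarith) (by simp)⟩

theorem exists_mem_apply_eq_zero_of_one_lt_finrank [Finite ι] {𝕜 : Type*} [Field 𝕜]
    {V : Submodule 𝕜 (ι → 𝕜)} (hV : 1 < Module.finrank 𝕜 V) (i : ι) : ∃ z ∈ V, z ≠ 0 ∧ z i = 0 := by
  have hker := LinearMap.ker_ne_bot_of_finrank_lt
    (f := (LinearMap.proj i : (ι → 𝕜) →ₗ[𝕜] 𝕜) ∘ₗ V.subtype) (by simpa using hV)
  obtain ⟨z, hz, hz0⟩ := Submodule.exists_mem_ne_zero_of_ne_bot hker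
  exact ⟨z, z.2, fun h => hz0 (Subtype.ext h), hz⟩

theorem exists_pivots_of_one_lt_finrank {𝕜 : Type*} [Field 𝕜] [LinearOrder ι] [Finite ι]
    {V : Submodule 𝕜 (ι → 𝕜)} (hV : 1 < Module.finrank 𝕜 V) :
    ∃ p q, p < q ∧ ∃ u ∈ V, ∃ v ∈ V, u p ≠ 0 ∧ v q ≠ 0 ∧ ∀ j < q, v j = 0 := by
  obtain ⟨u₀, hu₀, hu₀0⟩ := Submodule.exists_mem_ne_zero_of_ne_bot
    (Submodule.one_le_finrank_iff.1 hV.le)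
  obtain ⟨p, ⟨u, hu, hup⟩, hpmin⟩ := wellFounded_lt.has_min {p | ∃ u ∈ V, u p ≠ 0}
    ((Function.ne_iff.1 hu₀0).imp fun p hp => ⟨u₀, hu₀, hp⟩)
  obtain ⟨v, hv, hv0, hvp⟩ := exists_mem_apply_eq_zero_of_one_lt_finrank hV p
  obtain ⟨q, hvq, hqmin⟩ := wellFounded_lt.has_min {q | v q ≠ 0} (Function.ne_iff.1 hv0)
  have hpq : p ≠ q := fun h => hvq (h ▸ hvp)
  exact ⟨p, q, (not_lt.1 (hpmin q ⟨v, hv, hvq⟩)).lt_of_ne hpq, u, hu, v, hv, hup, hvq,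
    fun j hj => not_not.1 fun h => hqmin j h hj⟩

theorem apply_eq_zero_of_isBanded_of_mulVec_eq_smul {n k : ℕ} {A : Matrix (Fin n) (Fin n) ℂ}
    (hA : IsBanded k A) {μ : ℂ} {v : Fin n → ℂ} (hv : A *ᵥ v = μ • v) {r q : Fin n} (hrq : r < q)
    (hqr : (q : ℕ) = r + k) (hvq : v q ≠ 0) (hlt : ∀ j < q, v j = 0) : A r q = 0 := by
  have hrow : ∑ j, A r j * v j = 0 := by
    have h := congrFun hv r
    rwa [Pi.smul_apply, hlt r hrq, smul_zero] at h
  rw [Finset.sum_eq_single q ?_ (by simp)] at hrow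
  · exact (mul_eq_zero.1 hrow).resolve_right hvq
  · intro j _ hjq
    rcases lt_or_gt_of_ne hjq with hj | hj
    · rw [hlt j hj, mul_zero]
    · have hband : (k : ℤ) < |(j : ℤ) - r| := by
        have := le_abs_self ((j : ℤ) - r)
        rw [Fin.lt_def] at hj
        omega
      rw [hA r j hband, zero_mul]

end Eigenspaces

section Parametrization

variable {n k : ℕ} {J : Finset (Fin n)} {p q r : Fin n}

/-- The set of the matrices whose compression to the coordinates outside `J` is invertible: the
domain of `schurParam`. -/
def schurDomain (n k : ℕ) (J : Finset (Fin n)) : Set (skewHermitianBanded n k) :=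
  {B | IsUnit (compression (coordFrame ℂ J) (B : Matrix (Fin n) (Fin n) ℂ)).det}

theorem isOpen_schurDomain : IsOpen (schurDomain n k J) := by
  have hdet : Continuous fun B : skewHermitianBanded n k =>
      (compression (coordFrame ℂ J) (B : Matrix (Fin n) (Fin n) ℂ)).det :=
    ((compression (coordFrame ℂ J)).continuous_of_finiteDimensional.comp
      continuous_subtype_val).matrix_det
  simp only [schurDomain, isUnit_iff_ne_zero]
  exact isOpen_compl_singleton.preimage hdet

/-- The map `schurShift` on the space of skew-Hermitian matrices of bandwidth `k`. -/
noncomputable def schurParam (n k : ℕ) (J : Finset (Fin n)) (p q : Fin n) :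
    skewHermitianBanded n k → skewHermitianBanded n k :=
  (mapsTo_schurShift k J p q).restrict _ _ _

theorem contDiffAt_schurParam (p q : Fin n) {B : skewHermitianBanded n k}
    (hB : B ∈ schurDomain n k J) : ContDiffAt ℝ ∞ (schurParam n k J p q) B :=
  contDiffAt_restrict _ (contDiffAt_schurShift p q hB)

theorem injective_fderiv_schurParam (hpJ : p ∈ J) (hqJ : q ∈ J) {B : skewHermitianBanded n k}
    (hB : B ∈ schurDomain n k J) : Function.Injective (fderiv ℝ (schurParam n k J p q) B) :=
  injective_fderiv_restrict _ (contDiffAt_schurShift p q hB)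
    (injective_fderiv_schurShift hpJ hqJ B.2.1 hB)

theorem star_ofReal_mul_I (t : ℝ) : star (t * Complex.I) = -(t * Complex.I) := by
  simp

/-- The argument at which `schurParam` takes the value `A` if `t i` is an eigenvalue of `A` whose
eigenspace has the coordinates `J`: the matrix `A - t i` with its entries in the block with rows
and columns `p`, `q` replaced by `t i` at `(p, p)` and by zeros. -/
noncomputable def pinned (p q : Fin n) (A : skewHermitianBanded n k) (t : ℝ) :
    skewHermitianBanded n k :=
  let X : Matrix (Fin n) (Fin n) ℂ := A - (t * Complex.I) • 1
  ⟨X + bandBlock k {p, q} (Matrix.single p p (t * Complex.I) - X), by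
    have hX : X ∈ skewHermitianBanded n k :=
      sub_mem A.2 (smul_one_mem_skewHermitianBanded (star_ofReal_mul_I t))
    refine add_mem hX (bandBlock_mem_skewHermitianBanded ?_)
    rw [Matrix.conjTranspose_sub, conjTranspose_single_eq_neg (star_ofReal_mul_I t), hX.1]
    abel⟩

theorem coe_pinned (p q : Fin n) (A : skewHermitianBanded n k) (t : ℝ) :
    (pinned p q A t : Matrix (Fin n) (Fin n) ℂ) = A - (t * Complex.I) • 1 +
      bandBlock k {p, q} (Matrix.single p p (t * Complex.I) - (A - (t * Complex.I) • 1)) :=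
  rfl

theorem continuous_pinned (p q : Fin n) :
    Continuous fun x : skewHermitianBanded n k × ℝ => pinned p q x.1 x.2 := by
  have hband := (bandBlock k {p, q}).continuous_of_finiteDimensional
  have hsingle := (Matrix.singleLinearMap ℂ (α := ℂ) p p).continuous_of_finiteDimensional
  have hscalar : Continuous fun x : skewHermitianBanded n k × ℝ => x.2 * Complex.I := by fun_prop
  have hsub : Continuous fun x : skewHermitianBanded n k × ℝ =>
      (x.1 : Matrix (Fin n) (Fin n) ℂ) - (x.2 * Complex.I) • 1 := by fun_prop
  exact (hsub.add (hband.comp ((hsingle.comp hscalar).sub hsub))).subtype_mk _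

theorem pinned_apply_of_mem {i j : Fin n} (hi : i ∈ ({p, q} : Finset (Fin n)))
    (hj : j ∈ ({p, q} : Finset (Fin n))) (hij : |(j : ℤ) - i| ≤ k)
    (A : skewHermitianBanded n k) (t : ℝ) :
    (pinned p q A t : Matrix (Fin n) (Fin n) ℂ) i j = Matrix.single p p (t * Complex.I) i j := by
  rw [coe_pinned, Matrix.add_apply, bandBlock_apply, if_pos ⟨hi, hj, hij⟩,
    Matrix.sub_apply (Matrix.single _ _ _), add_sub_cancel]

theorem pinned_apply_of_notMem {i j : Fin n} (hi : i ∉ ({p, q} : Finset (Fin n))) (hij : i ≠ j)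
    (A : skewHermitianBanded n k) (t : ℝ) :
    (pinned p q A t : Matrix (Fin n) (Fin n) ℂ) i j = (A : Matrix (Fin n) (Fin n) ℂ) i j := by
  rw [coe_pinned, Matrix.add_apply, bandBlock_apply, if_neg fun h => hi h.1]
  simp [hij]

theorem pinned_mem_schurDomain_and_schurParam_pinned (hpJ : p ∈ J) (hqJ : q ∈ J)
    {A : skewHermitianBanded n k} {t : ℝ}
    (h : IsCompl (Module.End.eigenspace (Matrix.toLin' (A : Matrix (Fin n) (Fin n) ℂ))
      (t * Complex.I)) (vanishingOn ℂ J)) :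
    pinned p q A t ∈ schurDomain n k J ∧ schurParam n k J p q (pinned p q A t) = A := by
  set X : Matrix (Fin n) (Fin n) ℂ := A - (t * Complex.I) • 1 with hXA
  have hpq : {p, q} ⊆ J := by simp [Finset.insert_subset_iff, hpJ, hqJ]
  have hX : Xᴴ = -X :=
    (sub_mem A.2 (smul_one_mem_skewHermitianBanded (k := k) (star_ofReal_mul_I t))).1
  rw [eigenspace_toLin'_eq_ker, ← range_coordFrame] at h
  have hunit := isUnit_det_compression_of_isCompl hX (coordFrame_mulVec_injective J) h
  refine ⟨?_, Subtype.ext ?_⟩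
  · rw [schurDomain, Set.mem_ofPred_eq, coe_pinned, compression_add_bandBlock hpq]
    exact hunit
  · have hpp : (pinned p q A t : Matrix (Fin n) (Fin n) ℂ) p p = t * Complex.I := by
      rw [pinned_apply_of_mem (by simp) (by simp) (by simp), Matrix.single_apply_same]
    change schurShift k J p q (pinned p q A t) = A
    rw [schurShift_eq_add_smul_one, hpp, coe_pinned, schurTerm_add_bandBlock hpq, ← hXA,
      (isCompl_ker_range_iff hunit).1 h, add_assoc X, ← map_add, sub_add_sub_cancel, sub_self,
      map_zero, add_zero, hXA, sub_add_cancel]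

end Parametrization

section Constraints

variable {n k : ℕ} {q r : Fin n}

/-- The three real linear conditions which express a multiple eigenvalue in the coordinates
`schurParam`: the vanishing of the imaginary entry `B q q` and of the complex entry `B r q`. -/
noncomputable def constraintMap (n k : ℕ) (q r : Fin n) : skewHermitianBanded n k →ₗ[ℝ] ℝ × ℂ :=
  ((Complex.imLm ∘ₗ Matrix.entryLinearMap ℝ ℂ q q).prod (Matrix.entryLinearMap ℝ ℂ r q)) ∘ₗ
    (skewHermitianBanded n k).subtype

theorem mem_ker_constraintMap {B : skewHermitianBanded n k} :
    B ∈ LinearMap.ker (constraintMap n k q r) ↔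
      (B : Matrix (Fin n) (Fin n) ℂ) q q = 0 ∧ (B : Matrix (Fin n) (Fin n) ℂ) r q = 0 := by
  have hre := congrArg Complex.re (star_diag_eq_neg B.2.1 q)
  simp only [Complex.star_def, Complex.conj_re, Complex.neg_re] at hre
  have hqq : (B : Matrix (Fin n) (Fin n) ℂ) q q = 0 ↔
      ((B : Matrix (Fin n) (Fin n) ℂ) q q).im = 0 :=
    ⟨fun h => by rw [h, Complex.zero_im], fun h => Complex.ext (by simp; linarith) h⟩
  rw [hqq]
  exact Prod.mk_eq_zero

theorem sub_conjTranspose_mem_skewHermitianBanded {M : Matrix (Fin n) (Fin n) ℂ}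
    (hM : IsBanded k M) : M - Mᴴ ∈ skewHermitianBanded n k := by
  refine ⟨by rw [Matrix.conjTranspose_sub, Matrix.conjTranspose_conjTranspose, neg_sub],
    fun i j hij => ?_⟩
  rw [Matrix.sub_apply, Matrix.conjTranspose_apply, hM i j hij,
    hM j i (abs_sub_comm (i : ℤ) j ▸ hij), star_zero, sub_zero]

theorem isBanded_single (hrq : |(q : ℤ) - r| ≤ k) (z : ℂ) : IsBanded k (Matrix.single r q z) := by
  intro i j hij
  refine Matrix.single_apply_of_ne _ _ _ _ _ ?_
  rintro ⟨rfl, rfl⟩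
  exact hij.not_ge hrq

theorem constraintMap_surjective (hrq : r ≠ q) (hband : |(q : ℤ) - r| ≤ k) :
    Function.Surjective (constraintMap n k q r) := by
  rintro ⟨x, z⟩
  let M : Matrix (Fin n) (Fin n) ℂ :=
    Matrix.single q q (x / 2 * Complex.I) + Matrix.single r q z
  have hM : IsBanded k M := fun i j hij =>
    (congrArg₂ (· + ·) (isBanded_single (by simp) _ i j hij)
      (isBanded_single hband _ i j hij)).trans (add_zero 0)
  refine ⟨⟨M - Mᴴ, sub_conjTranspose_mem_skewHermitianBanded hM⟩, Prod.ext ?_ ?_⟩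
  · change ((M - Mᴴ) q q).im = x
    simp [M, hrq]
  · change (M - Mᴴ) r q = z
    simp [M, hrq, hrq.symm]

theorem finrank_skewHermitianBanded_eq (hrq : r ≠ q) (hband : |(q : ℤ) - r| ≤ k) :
    Module.finrank ℝ (skewHermitianBanded n k) =
      Module.finrank ℝ (LinearMap.ker (constraintMap n k q r)) + 3 := by
  have h := LinearMap.finrank_range_add_finrank_ker (constraintMap n k q r)
  rw [LinearMap.range_eq_top.2 (constraintMap_surjective hrq hband), finrank_top,
    Module.finrank_prod, Module.finrank_self, Complex.finrank_real_complex] at h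
  lia

end Constraints

section DerogatoryMatrices

variable {n k : ℕ} {p q r : Fin n}

theorem pinned_apply_self_right (hpq : p ≠ q) (A : skewHermitianBanded n k) (t : ℝ) :
    (pinned p q A t : Matrix (Fin n) (Fin n) ℂ) q q = 0 := by
  rw [pinned_apply_of_mem (by simp) (by simp) (by simp),
    Matrix.single_apply_of_ne _ _ _ _ _ fun h => hpq h.1]

theorem pinned_mem_ker_constraintMap (hpq : p ≠ q) (hband : |(q : ℤ) - p| ≤ k)
    (A : skewHermitianBanded n k) (t : ℝ) :
    pinned p q A t ∈ LinearMap.ker (constraintMap n k q p) := by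
  refine mem_ker_constraintMap.2 ⟨pinned_apply_self_right hpq A t, ?_⟩
  rw [pinned_apply_of_mem (by simp) (by simp) hband,
    Matrix.single_apply_of_ne _ _ _ _ _ fun h => hpq h.2]

theorem exists_pinned_mem_ker_constraintMap (hk : 0 < k) (hpq : p < q)
    {A : skewHermitianBanded n k} {μ : ℂ} {v : Fin n → ℂ}
    (hv : (A : Matrix (Fin n) (Fin n) ℂ) *ᵥ v = μ • v) (hvq : v q ≠ 0) (hlt : ∀ j < q, v j = 0)
    (t : ℝ) :
    ∃ r, r ≠ q ∧ |(q : ℤ) - r| ≤ k ∧ pinned p q A t ∈ LinearMap.ker (constraintMap n k q r) := by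
  by_cases hband : |(q : ℤ) - p| ≤ k
  · exact ⟨p, hpq.ne, hband, pinned_mem_ker_constraintMap hpq.ne hband A t⟩
  have hpkq : (p : ℕ) + k < q := by
    rw [abs_of_pos (sub_pos.2 (Nat.cast_lt.2 hpq))] at hband
    omega
  let r : Fin n := ⟨q - k, by omega⟩
  have hr : (q : ℕ) = r + k := (Nat.sub_add_cancel (by omega)).symm
  have hrp : r ≠ p := by
    rw [Ne, Fin.ext_iff]
    omega
  have hrq : r < q := by
    rw [Fin.lt_def]
    omega
  refine ⟨r, hrq.ne, by rw [hr]; simp, mem_ker_constraintMap.2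
    ⟨pinned_apply_self_right hpq.ne A t, ?_⟩⟩
  rw [pinned_apply_of_notMem (by simp [hrp, hrq.ne]) hrq.ne]
  exact apply_eq_zero_of_isBanded_of_mulVec_eq_smul A.2.2 hv hrq hr hvq hlt

theorem exists_mem_image_schurParam (hk : 0 < k) {A : skewHermitianBanded n k}
    (hA : A ∈ derogatorySkewHermitianBanded n k) :
    ∃ (J : Finset (Fin n)) (p q r : Fin n) (_ : p ∈ J ∧ q ∈ J ∧ r ≠ q ∧ |(q : ℤ) - r| ≤ k),
      A ∈ schurParam n k J p q '' (schurDomain n k J ∩ LinearMap.ker (constraintMap n k q r)) := by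
  obtain ⟨μ, hμ⟩ := hA
  obtain ⟨p, q, hpq, u, hu, v, hv, hup, hvq, hlt⟩ := exists_pivots_of_one_lt_finrank hμ
  have hAv := Module.End.mem_eigenspace_iff.1 hv
  obtain ⟨t, rfl⟩ :=
    exists_eq_ofReal_mul_I_of_mulVec_eq_smul A.2.1 hAv (Function.ne_iff.2 ⟨q, hvq⟩)
  obtain ⟨J, hJ, hcompl⟩ := exists_isCompl_vanishingOn_of_codisjoint
    (codisjoint_vanishingOn_pair hu hv hup (hlt p hpq) hvq)
  have hpJ : p ∈ J := hJ (by simp)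
  have hqJ : q ∈ J := hJ (by simp)
  obtain ⟨hdom, hval⟩ := pinned_mem_schurDomain_and_schurParam_pinned hpJ hqJ hcompl
  obtain ⟨r, hrq, hband, hker⟩ := exists_pinned_mem_ker_constraintMap hk hpq hAv hvq hlt t
  exact ⟨J, p, q, r, ⟨hpJ, hqJ, hrq, hband⟩, _, ⟨hdom, hker⟩, hval⟩

theorem coveredBySubmanifolds_derogatorySkewHermitianBanded (hk : 0 < k) {d : ℕ}
    (hd : Module.finrank ℝ (skewHermitianBanded n k) = d + 3) :
    CoveredBySubmanifolds (derogatorySkewHermitianBanded n k) d := by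
  refine CoveredBySubmanifolds.mono (.iUnion fun J : Finset (Fin n) => .iUnion fun p : Fin n =>
    .iUnion fun q : Fin n => .iUnion fun r : Fin n =>
    .iUnion fun h : p ∈ J ∧ q ∈ J ∧ r ≠ q ∧ |(q : ℤ) - r| ≤ k => ?_)
    fun A hA => by simpa only [Set.mem_iUnion] using exists_mem_image_schurParam hk hA
  obtain ⟨hpJ, hqJ, hrq, hband⟩ := h
  have hker : Module.finrank ℝ (LinearMap.ker (constraintMap n k q r)) = d := by
    have := finrank_skewHermitianBanded_eq hrq hband
    lia
  exact hker ▸ .image_of_injective_fderiv isOpen_schurDomain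
    (fun B hB => contDiffAt_schurParam p q hB)
    (fun B hB => injective_fderiv_schurParam hpJ hqJ hB) _

theorem schurParam_mem_derogatorySkewHermitianBanded (hpq : p ≠ q) (hband : |(q : ℤ) - p| ≤ k)
    {B : skewHermitianBanded n k} (hB : B ∈ schurDomain n k {p, q})
    (hker : B ∈ LinearMap.ker (constraintMap n k q p)) :
    schurParam n k {p, q} p q B ∈ derogatorySkewHermitianBanded n k := by
  obtain ⟨X, hX⟩ := B
  obtain ⟨hqq, hpq0⟩ : X q q = 0 ∧ X p q = 0 := mem_ker_constraintMap.1 hker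
  have hqp0 : X q p = 0 := by
    have := congrFun₂ hX.1 q p
    rwa [Matrix.conjTranspose_apply, hpq0, star_zero, eq_comm, Matrix.neg_apply,
      neg_eq_zero] at this
  have hs : ∀ i ∈ ({p, q} : Finset (Fin n)), ∀ j ∈ ({p, q} : Finset (Fin n)),
      |(j : ℤ) - i| ≤ k := by
    simp [hband, abs_sub_comm (p : ℤ)]
  have hblock : bandBlock k {p, q} X = Matrix.single p p (X p p) := by
    rw [← bandBlock_single (k := k) (Finset.mem_insert_self p {q})]
    ext i j
    rw [bandBlock_apply, bandBlock_apply]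
    refine if_ctx_congr Iff.rfl (fun h => ?_) fun _ => rfl
    rcases Finset.mem_insert.1 h.1 with rfl | hi <;> rcases Finset.mem_insert.1 h.2.1 with rfl | hj
    all_goals simp_all
  set S := schurTerm (coordFrame ℂ {p, q}) X with hS
  have hSX : bandBlock k {p, q} (S - X) = S - X :=
    bandBlock_eq_self hs (by rw [Matrix.sub_mul, schurTerm_mul hB, sub_self])
      (by rw [Matrix.mul_sub, conjTranspose_mul_schurTerm hB, sub_self])
  have hshift : schurShift k {p, q} p q X - X p p • 1 = S := by
    rw [schurShift_eq_add_smul_one, add_sub_cancel_right, ← hS, map_sub, bandBlock_single (by simp),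
      ← hblock, ← map_sub, hSX, add_sub_cancel]
  refine ⟨X p p, ?_⟩
  change 1 < Module.finrank ℂ
    (Module.End.eigenspace (Matrix.toLin' (schurShift k {p, q} p q X)) (X p p))
  have hcompl := isCompl_ker_schurTerm hB
  rw [range_coordFrame] at hcompl
  rw [eigenspace_toLin'_eq_ker, hshift, finrank_eq_card_of_isCompl_vanishingOn hcompl,
    Finset.card_pair hpq]
  exact one_lt_two

end DerogatoryMatrices

section DiagonalMatrices

variable {ι : Type*} [Fintype ι] [DecidableEq ι]

theorem isCompl_eigenspace_diagonal_vanishingOn {d : ι → ℂ} {J : Finset ι}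
    (hd : ∀ i, d i = 0 ↔ i ∈ J) :
    IsCompl (Module.End.eigenspace (Matrix.toLin' (Matrix.diagonal d)) 0) (vanishingOn ℂ J) := by
  have hmem (z : ι → ℂ) : z ∈ Module.End.eigenspace (Matrix.toLin' (Matrix.diagonal d)) 0 ↔
      ∀ i, d i = 0 ∨ z i = 0 := by
    simp [funext_iff, Matrix.mulVec_diagonal]
  refine ⟨Submodule.disjoint_def.2 fun z hz hzJ => funext fun i => ?_,
    Submodule.codisjoint_iff_exists_add_eq.2 fun y => ⟨fun i => if i ∈ J then y i else 0,
      fun i => if i ∈ J then 0 else y i, (hmem _).2 fun i => ?_, mem_vanishingOn.2 fun i hi => ?_,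
      funext fun i => ?_⟩⟩
  · exact ((hmem z).1 hz i).elim (fun h => mem_vanishingOn.1 hzJ i ((hd i).1 h)) id
  · rw [hd, ite_eq_right_iff]
    tauto
  · exact if_pos hi
  · rw [Pi.add_apply]
    split_ifs <;> simp

theorem exists_apply_ne_zero_and_norm_sub_le {A : Matrix ι ι ℂ} {d : ι → ℂ} {δ : ℝ}
    (hδ : ∀ i j, ‖A i j - Matrix.diagonal d i j‖ ≤ δ) {μ : ℂ} {z : ι → ℂ}
    (hz : A *ᵥ z = μ • z) (hz0 : z ≠ 0) :
    ∃ i, z i ≠ 0 ∧ ‖μ - d i‖ ≤ Fintype.card ι * δ := by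
  obtain ⟨i₀, hi₀⟩ := Function.ne_iff.1 hz0
  have : Nonempty ι := ⟨i₀⟩
  obtain ⟨i, hi⟩ := Finite.exists_max fun i => ‖z i‖
  have hpos : 0 < ‖z i‖ := (norm_pos_iff.2 hi₀).trans_le (hi i₀)
  have hrow : (μ - d i) * z i = ∑ j, (A i j - Matrix.diagonal d i j) * z j := by
    have h := congrFun (Matrix.sub_mulVec A (Matrix.diagonal d) z) i
    rw [Pi.sub_apply, hz, Matrix.mulVec_diagonal] at h
    rw [sub_mul]
    exact h.symm
  refine ⟨i, norm_pos_iff.1 hpos, le_of_mul_le_mul_right ?_ hpos⟩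
  calc ‖μ - d i‖ * ‖z i‖ = ‖∑ j, (A i j - Matrix.diagonal d i j) * z j‖ := by
        rw [← norm_mul, hrow]
    _ ≤ ∑ j, ‖A i j - Matrix.diagonal d i j‖ * ‖z j‖ :=
        norm_sum_le_of_le _ fun j _ => norm_mul_le _ _
    _ ≤ ∑ _j : ι, δ * ‖z i‖ := by
        gcongr with j
        · exact (norm_nonneg _).trans (hδ i j)
        · exact hδ i j
        · exact hi j
    _ = Fintype.card ι * δ * ‖z i‖ := by simp [mul_assoc]

theorem norm_le_and_isCompl_vanishingOn_of_near_diagonal {A : Matrix ι ι ℂ} {d : ι → ℂ} {δ : ℝ}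
    {p q : ι} (hd : ∀ i ∈ ({p, q} : Finset ι), d i = 0)
    (hsep : ∀ i ∉ ({p, q} : Finset ι), ∀ j ≠ i, 1 ≤ ‖d i - d j‖)
    (hδ : ∀ i j, ‖A i j - Matrix.diagonal d i j‖ ≤ δ) (hsmall : Fintype.card ι * δ < 1 / 2) {μ : ℂ}
    (hμ : 1 < Module.finrank ℂ (Module.End.eigenspace (Matrix.toLin' A) μ)) :
    ‖μ‖ ≤ Fintype.card ι * δ ∧
      IsCompl (Module.End.eigenspace (Matrix.toLin' A) μ) (vanishingOn ℂ {p, q}) := by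
  have hex (z : ι → ℂ) (hz : z ∈ Module.End.eigenspace (Matrix.toLin' A) μ) (hz0 : z ≠ 0) :=
    exists_apply_ne_zero_and_norm_sub_le hδ (Module.End.mem_eigenspace_iff.1 hz) hz0
  have hpair (i j : ι) (hij : j ≠ i) (hi : ‖μ - d i‖ ≤ Fintype.card ι * δ)
      (hj : ‖μ - d j‖ ≤ Fintype.card ι * δ) : i ∈ ({p, q} : Finset ι) := by
    by_contra h
    have := norm_sub_le (μ - d j) (μ - d i)
    rw [sub_sub_sub_cancel_left] at this
    linarith [hsep i h j hij]
  have hμ0 : ‖μ‖ ≤ Fintype.card ι * δ := by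
    obtain ⟨z, hz, hz0, -⟩ := exists_mem_apply_eq_zero_of_one_lt_finrank hμ p
    obtain ⟨i, -, hi⟩ := hex z hz hz0
    obtain ⟨w, hw, hw0, hwi⟩ := exists_mem_apply_eq_zero_of_one_lt_finrank hμ i
    obtain ⟨j, hwj, hj⟩ := hex w hw hw0
    rwa [hd i (hpair i j (fun h => hwj (h ▸ hwi)) hi hj), sub_zero] at hi
  refine ⟨hμ0, isCompl_vanishingOn_of_card_le (Finset.card_le_two.trans hμ) fun z hz hzJ => ?_⟩
  by_contra hz0
  obtain ⟨i, hzi, hi⟩ := hex z hz hz0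
  have hp : ‖μ - d p‖ ≤ Fintype.card ι * δ := by rwa [hd p (by simp), sub_zero]
  have hpi : p ≠ i := fun h => hzi (hzJ i (by simp [h]))
  exact hzi (hzJ i (hpair i p hpi hi hp))

end DiagonalMatrices

section RegularPoint

open Topology

variable {n k : ℕ} {p q : Fin n}

/-- The diagonal entries of `modelMatrix`, divided by `i`: zero at `p`, `q`, and distinct positive
integers elsewhere. -/
def modelSpectrum (p q i : Fin n) : ℕ :=
  if i ∈ ({p, q} : Finset (Fin n)) then 0 else i + 1

theorem modelSpectrum_eq_zero_iff {i : Fin n} :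
    modelSpectrum p q i = 0 ↔ i ∈ ({p, q} : Finset (Fin n)) := by
  simp only [modelSpectrum, ite_eq_left_iff]
  tauto

theorem one_le_norm_modelSpectrum_sub {i : Fin n} (hi : i ∉ ({p, q} : Finset (Fin n)))
    {j : Fin n} (hij : j ≠ i) :
    1 ≤ ‖modelSpectrum p q i * Complex.I - modelSpectrum p q j * Complex.I‖ := by
  have hne : modelSpectrum p q i ≠ modelSpectrum p q j := by
    rw [Ne, Fin.ext_iff] at hij
    simp only [modelSpectrum, if_neg hi]
    split_ifs <;> lia
  rw [← sub_mul, norm_mul, Complex.norm_I, mul_one, ← Int.cast_natCast (modelSpectrum p q i),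
    ← Int.cast_natCast (modelSpectrum p q j), ← Int.cast_sub, Complex.norm_intCast]
  exact_mod_cast Int.one_le_abs (sub_ne_zero.2 (Nat.cast_injective.ne hne))

/-- A skew-Hermitian diagonal matrix which has a single multiple eigenvalue, namely `0`, with the
standard basis vectors at `p`, `q` as eigenvectors: a regular point of the set of derogatory
matrices. -/
noncomputable def modelMatrix (k : ℕ) (p q : Fin n) : skewHermitianBanded n k :=
  ⟨Matrix.diagonal fun i => modelSpectrum p q i * Complex.I, by
    refine ⟨?_, fun i j hij => Matrix.diagonal_apply_ne _ ?_⟩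
    · rw [Matrix.diagonal_conjTranspose, Matrix.diagonal_neg]
      congr 1
      ext i
      simp
    · rintro rfl
      exact hij.not_ge (by simp)⟩

theorem isCompl_eigenspace_modelMatrix :
    IsCompl (Module.End.eigenspace
      (Matrix.toLin' (modelMatrix k p q : Matrix (Fin n) (Fin n) ℂ)) ((0 : ℝ) * Complex.I))
      (vanishingOn ℂ {p, q}) := by
  rw [Complex.ofReal_zero, zero_mul]
  refine isCompl_eigenspace_diagonal_vanishingOn fun i => ?_
  rw [← modelSpectrum_eq_zero_iff]
  simp

theorem modelMatrix_mem_derogatorySkewHermitianBanded (hpq : p ≠ q) :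
    modelMatrix k p q ∈ derogatorySkewHermitianBanded n k :=
  ⟨_, by
    rw [finrank_eq_card_of_isCompl_vanishingOn isCompl_eigenspace_modelMatrix,
      Finset.card_pair hpq]
    exact one_lt_two⟩

theorem pinned_modelMatrix_zero : pinned p q (modelMatrix k p q) 0 = modelMatrix k p q := by
  have hblock : bandBlock k {p, q} (modelMatrix k p q : Matrix (Fin n) (Fin n) ℂ) = 0 := by
    ext i j
    rw [bandBlock_apply, Matrix.zero_apply, ite_eq_right_iff]
    rintro ⟨hi, -, -⟩
    simp [modelMatrix, Matrix.diagonal_apply, modelSpectrum_eq_zero_iff.2 hi]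
  refine Subtype.ext ?_
  rw [coe_pinned]
  simp [hblock]

theorem eventually_mem_image_schurParam (hpq : p ≠ q) (hband : |(q : ℤ) - p| ≤ k)
    {U : Set (skewHermitianBanded n k)} (hU : U ∈ 𝓝 (modelMatrix k p q)) :
    ∀ᶠ A in 𝓝 (modelMatrix k p q), A ∈ derogatorySkewHermitianBanded n k →
      A ∈ schurParam n k {p, q} p q '' (U ∩ LinearMap.ker (constraintMap n k q p)) := by
  have hpinned := (continuous_pinned (k := k) p q).tendsto' (modelMatrix k p q, 0) _
    pinned_modelMatrix_zero hU
  obtain ⟨V, hV, W, hW, hVW⟩ := mem_nhds_prod_iff.1 hpinned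
  obtain ⟨ε, hε, hεW⟩ := Metric.mem_nhds_iff.1 hW
  obtain ⟨δ, hδ, hδε⟩ := exists_pos_mul_lt (lt_min hε one_half_pos) n
  have hnear : ∀ᶠ A : skewHermitianBanded n k in 𝓝 (modelMatrix k p q), ∀ i j,
      ‖(A : Matrix (Fin n) (Fin n) ℂ) i j - (modelMatrix k p q : Matrix (Fin n) (Fin n) ℂ) i j‖ ≤
        δ := by
    refine Filter.eventually_all.2 fun i => Filter.eventually_all.2 fun j => ?_
    have hentry : Continuous fun A : skewHermitianBanded n k =>
        (A : Matrix (Fin n) (Fin n) ℂ) i j :=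
      (Matrix.entryLinearMap ℝ ℂ i j).continuous_of_finiteDimensional.comp continuous_subtype_val
    filter_upwards [Metric.tendsto_nhds.1 (hentry.tendsto (modelMatrix k p q)) δ hδ] with A hA
    rw [dist_eq_norm] at hA
    exact hA.le
  filter_upwards [hV, hnear] with A hAV hA ⟨μ, hμ⟩
  obtain ⟨z, hz, hz0, -⟩ := exists_mem_apply_eq_zero_of_one_lt_finrank hμ p
  obtain ⟨t, rfl⟩ := exists_eq_ofReal_mul_I_of_mulVec_eq_smul A.2.1
    (Module.End.mem_eigenspace_iff.1 hz) hz0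
  obtain ⟨ht, hcompl⟩ := norm_le_and_isCompl_vanishingOn_of_near_diagonal
    (fun i hi => by simp [modelSpectrum_eq_zero_iff.2 hi])
    (fun i hi j hij => one_le_norm_modelSpectrum_sub hi hij) hA
    (by rw [Fintype.card_fin]; exact hδε.trans_le (min_le_right _ _)) hμ
  have htε : t ∈ Metric.ball 0 ε := by
    rw [norm_mul, Complex.norm_I, mul_one, Complex.norm_real, Fintype.card_fin] at ht
    rw [mem_ball_zero_iff]
    exact ht.trans_lt (hδε.trans_le (min_le_left _ _))
  exact ⟨pinned p q A t, ⟨hVW (Set.mk_mem_prod hAV (hεW htε)),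
    pinned_mem_ker_constraintMap hpq hband A t⟩,
    (pinned_mem_schurDomain_and_schurParam_pinned (by simp) (by simp) hcompl).2⟩

theorem exists_isOpen_isEmbeddedSubmanifold_inter (hpq : p ≠ q) (hband : |(q : ℤ) - p| ≤ k) :
    ∃ U, IsOpen U ∧ (derogatorySkewHermitianBanded n k ∩ U).Nonempty ∧
      IsEmbeddedSubmanifold (derogatorySkewHermitianBanded n k ∩ U)
        (Module.finrank ℝ (LinearMap.ker (constraintMap n k q p))) := by
  have hdom : modelMatrix k p q ∈ schurDomain n k {p, q} := by
    rw [← pinned_modelMatrix_zero]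
    exact (pinned_mem_schurDomain_and_schurParam_pinned (by simp) (by simp)
      isCompl_eigenspace_modelMatrix).1
  obtain ⟨Φ, hmodel, hsource, hΦT, hΦ, hΦ'⟩ := exists_openPartialHomeomorph_of_injective_fderiv
    isOpen_schurDomain (fun B hB => contDiffAt_schurParam p q hB)
    (fun B hB => injective_fderiv_schurParam (by simp) (by simp) hB) hdom
  refine (isEmbeddedSubmanifold_image Φ hΦ hΦ' _).exists_isOpen_inter ?_
    (modelMatrix_mem_derogatorySkewHermitianBanded hpq) ?_
  · rintro _ ⟨B, ⟨hB, hker⟩, rfl⟩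
    rw [hΦT]
    exact schurParam_mem_derogatorySkewHermitianBanded hpq hband (hsource hB) hker
  · rw [funext hΦT]
    exact eventually_mem_image_schurParam hpq hband (Φ.open_source.mem_nhds hmodel)

end RegularPoint

theorem mainTheorem8 (n k : ℕ) (hk : 0 < k) (hkn : k < n) :
    HasCodimension (derogatorySkewHermitianBanded n k) 3 := by
  let p : Fin n := ⟨0, by lia⟩
  let q : Fin n := ⟨1, by lia⟩
  have hpq : p ≠ q := by simp [p, q]
  have hband : |(q : ℤ) - p| ≤ k := by simpa [p, q] using Nat.succ_le_of_lt hk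
  have hcodim := finrank_skewHermitianBanded_eq hpq hband
  exact ⟨_, ⟨exists_isOpen_isEmbeddedSubmanifold_inter hpq hband,
    (coveredBySubmanifolds_derogatorySkewHermitianBanded hk hcodim).exists_seq⟩, hcodim⟩
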